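/- Let $\mathbb H$ be the real quaternions and let $\mathbb H[q_1,q_2]$ be the ring of slice regular polynomials $P(q_1,q_2)=\sum_{n,m}q_1^nq_2^m a_{n,m}$ (finite sums, $a_{n,m}\in\mathbb H$) with the $*$-product, $(q_1^nq_2^ma)*(q_1^rq_2^sb)=q_1^{n+r}q_2^{m+s}ab$ extended biadditively. Let $P_{q_2}=\sum_{n\ge 0,\,m\ge1}m\,q_1^nq_2^{m-1}a_{n,m}$ be the partial Cullen derivative of $P$. If $P$ vanishes on $\mathbb H\times\{b\}$, we say that the multiplicity of this zero is $n$ if $P=(q_2-b)^{*n}*S$ for some $S\in\mathbb H[q_1,q_2]$ that does not vanish identically on $\mathbb H\times\{b\}$. Write $P=\sum_{k=0}^{r}q_2^k*\tilde P_k(q_1)$ and $Q=\sum_{k=0}^{s}q_2^k*\tilde Q_k(q_1)$ with $\tilde P_k,\tilde Q_k\in\mathbb H[q_1]$, $r=\deg_{q_2}P$, $s=\deg_{q_2}Q$. The regular resultant $\mathrm{Res}(P,Q;q_2)$ with respect to $q_2$ is the Dieudonné determinant of the $(r+s)\times(r+s)$ Sylvester matrix whose first $s$ columns are the shifts of $(\tilde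 P_0,\dots,\tilde P_r)^t$ and whose last $r$ columns are the shifts of $(\tilde Q_0,\dots,\tilde Q_s)^t$. It is computed over the skew field $\mathcal L(\mathbb H)\supset\mathbb H[q_1]$ of $*$-quotients of slice regular functions on $\mathbb H$ (everywhere convergent power series $\sum q^na_n$), and takes values in the abelianization of $\mathcal L(\mathbb H)\setminus\{0\}$ together with the class of $0$. **Proposition.** Let $a,b\in\mathbb H$ with $b\in C_a=\{q\in\mathbb H: qa=aq\}$, and let $P\in\mathbb H[q_1,q_2]$ vanish at $(a,b)$. If $P$ vanishes on $\mathbb H\times\{b\}$ and the multiplicity $n$ of this zero is at least $2$, then $\mathrm{Res}(P,P_{q_2};q_2)\equiv0$. -/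

import Mathlib

open Polynomial
open scoped Quaternion nonZeroDivisors

noncomputable section

/-! ### Slice regular polynomials in two quaternionic variables

The real quaternions are `ℍ[ℝ]`.  A slice regular polynomial `∑ q₁ⁿ q₂ᵐ a_{n,m}` is given by its
(uniquely determined) coefficients.  In Mathlib's `Polynomial` over a noncommutative ring the
variable commutes with the coefficients and coefficients are convolved, so the ring product *is*
the `*`-product. -/

/-- Slice regular polynomials in one quaternionic variable `q₁`, with the `*`-product. -/
abbrev SlicePoly₁ : Type := ℍ[ℝ][X]

/-- Slice regular polynomials in `(q₁, q₂)` with the `*`-product, written as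
`∑ q₂ᵐ * P̃ₘ(q₁)`: the outer variable is `q₂`, the inner variable is `q₁`, and the coefficient
`a_{n,m}` of `q₁ⁿ q₂ᵐ` is `(P.coeff m).coeff n`. -/
abbrev SlicePoly₂ : Type := SlicePoly₁[X]

namespace SlicePoly₂

/-- The value `P(q₁, q₂) = ∑ q₁ⁿ q₂ᵐ a_{n,m}`, with the coefficients on the right. -/
def evalAt (P : SlicePoly₂) (q₁ q₂ : ℍ[ℝ]) : ℍ[ℝ] :=
  P.sum fun m p => p.sum fun n c => q₁ ^ n * q₂ ^ m * c

/-- `P` vanishes identically on a subset of `ℍ × ℍ`. -/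
def VanishesOn (P : SlicePoly₂) (Z : Set (ℍ[ℝ] × ℍ[ℝ])) : Prop :=
  ∀ z ∈ Z, P.evalAt z.1 z.2 = 0

/-- The slice regular polynomial `q₂ - b`. -/
def q₂Sub (b : ℍ[ℝ]) : SlicePoly₂ := X - C (C b)

/-- The partial Cullen derivative `∑ m q₁ⁿ q₂ᵐ⁻¹ a_{n,m}` with respect to `q₂`. -/
def cullenDeriv₂ (P : SlicePoly₂) : SlicePoly₂ := derivative P

/-- `deg_{q₂} P`. -/
def degree₂ (P : SlicePoly₂) : ℕ := P.natDegree

/-- `P` vanishes on `ℍ × {b}`, and the multiplicity of this zero is `n`. -/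
def HasMultiplicity₂ (P : SlicePoly₂) (b : ℍ[ℝ]) (n : ℕ) : Prop :=
  P.VanishesOn (Set.univ ×ˢ {b}) ∧
    ∃ S : SlicePoly₂, ¬ S.VanishesOn (Set.univ ×ˢ {b}) ∧ P = q₂Sub b ^ n * S

end SlicePoly₂

/-! ### Entire slice regular functions and their skew field of `*`-quotients -/

/-- The conjugate power series `∑ qⁿ āₙ`. -/
def regularConj (f : PowerSeries ℍ[ℝ]) : PowerSeries ℍ[ℝ] :=
  PowerSeries.mk fun n => star (PowerSeries.coeff n f)

theorem regularConj_ne_zero {f : PowerSeries ℍ[ℝ]} (hf : f ≠ 0) : regularConj f ≠ 0 := by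
  contrapose! hf
  ext1 n
  have h := congrArg (PowerSeries.coeff n) hf
  simpa [regularConj] using h

/-- The symmetrization `fᶜ * f` has real coefficients, hence is central. -/
theorem regularConj_mul_self_comm (f g : PowerSeries ℍ[ℝ]) :
    (regularConj f * f) * g = g * (regularConj f * f) := by
  have hreal : ∀ n, star (PowerSeries.coeff n (regularConj f * f))
      = PowerSeries.coeff n (regularConj f * f) := by
    intro n
    rw [PowerSeries.coeff_mul, star_sum, ← Finset.Nat.sum_antidiagonal_swap]
    refine Finset.sum_congr rfl fun p _ => ?_
    simp [regularConj]
  have hcomm : ∀ n (c : ℍ[ℝ]), PowerSeries.coeff n (regularConj f * f) * c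
      = c * PowerSeries.coeff n (regularConj f * f) := by
    intro n c
    rw [Quaternion.star_eq_self.mp (hreal n)]
    exact Quaternion.coe_commutes _ _
  ext1 n
  rw [PowerSeries.coeff_mul, PowerSeries.coeff_mul, ← Finset.Nat.sum_antidiagonal_swap]
  exact Finset.sum_congr rfl fun p _ => hcomm _ _

/-- `∑ qⁿ aₙ` converges for every quaternion `q`. -/
def IsEntireSeries (f : PowerSeries ℍ[ℝ]) : Prop :=
  ∀ q : ℍ[ℝ], Summable fun n : ℕ => q ^ n * PowerSeries.coeff n f

theorem isEntireSeries_iff {f : PowerSeries ℍ[ℝ]} :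
    IsEntireSeries f ↔ ∀ q : ℍ[ℝ], Summable fun n : ℕ => ‖q‖ ^ n * ‖PowerSeries.coeff n f‖ := by
  refine forall_congr' fun q => ?_
  rw [← summable_norm_iff]
  simp only [norm_mul, norm_pow]

theorem IsEntireSeries.mul {f g : PowerSeries ℍ[ℝ]} (hf : IsEntireSeries f)
    (hg : IsEntireSeries g) : IsEntireSeries (f * g) := by
  rw [isEntireSeries_iff] at *
  intro q
  have h := summable_norm_sum_mul_antidiagonal_of_summable_norm (hf q).norm (hg q).norm
  refine Summable.of_nonneg_of_le (fun n => by positivity) (fun n => ?_) h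
  rw [Real.norm_of_nonneg (Finset.sum_nonneg fun p _ => by positivity), PowerSeries.coeff_mul]
  calc ‖q‖ ^ n * ‖∑ p ∈ Finset.HasAntidiagonal.antidiagonal n, PowerSeries.coeff p.1 f * PowerSeries.coeff p.2 g‖
      ≤ ‖q‖ ^ n * ∑ p ∈ Finset.HasAntidiagonal.antidiagonal n,
          ‖PowerSeries.coeff p.1 f * PowerSeries.coeff p.2 g‖ := by
        gcongr
        exact norm_sum_le _ _
    _ = _ := by
        rw [Finset.mul_sum]
        refine Finset.sum_congr rfl fun p hp => ?_
        rw [norm_mul, ← Finset.HasAntidiagonal.mem_antidiagonal.mp hp, pow_add]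
        ring

theorem isEntireSeries_coe (p : SlicePoly₁) : IsEntireSeries (p : PowerSeries ℍ[ℝ]) := by
  intro q
  refine summable_of_ne_finset_zero (s := p.support) fun n hn => ?_
  rw [Polynomial.coeff_coe, Polynomial.notMem_support_iff.mp hn, mul_zero]

/-- The ring `SR(ℍ)` of slice regular functions on `ℍ`, i.e. of everywhere convergent power series
`∑ qⁿ aₙ`, with the `*`-product. -/
def SliceRegular : Subring (PowerSeries ℍ[ℝ]) where
  carrier := {f | IsEntireSeries f}
  mul_mem' := IsEntireSeries.mul
  one_mem' := by simpa using isEntireSeries_coe 1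
  zero_mem' := by simpa using isEntireSeries_coe 0
  add_mem' := by
    intro f g hf hg q
    simpa [mul_add] using (hf q).add (hg q)
  neg_mem' := by
    intro f hf q
    simpa using (hf q).neg

theorem regularConj_mem {f : PowerSeries ℍ[ℝ]} (hf : f ∈ SliceRegular) :
    regularConj f ∈ SliceRegular := by
  have hf' : IsEntireSeries f := hf
  change IsEntireSeries (regularConj f)
  rw [isEntireSeries_iff] at *
  simpa [regularConj] using hf'

/-- The regular conjugate `fᶜ` on `SR(ℍ)`. -/
def SliceRegular.conj (f : SliceRegular) : SliceRegular := ⟨regularConj f, regularConj_mem f.2⟩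

theorem SliceRegular.conj_mul_self_mem (f : (SliceRegular)⁰) :
    SliceRegular.conj f * f ∈ (SliceRegular)⁰ := by
  refine mem_nonZeroDivisors_of_ne_zero (mul_ne_zero (fun h => ?_) (nonZeroDivisors.coe_ne_zero f))
  refine regularConj_ne_zero (f := ((f : SliceRegular) : PowerSeries ℍ[ℝ])) ?_
    (congrArg Subtype.val h)
  exact fun h0 => nonZeroDivisors.coe_ne_zero f (Subtype.ext h0)

/-- The left Ore condition in `SR(ℍ)`: `(sᶜ * s) * r = (r * sᶜ) * s`. -/
instance : OreLocalization.OreSet (SliceRegular)⁰ :=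
  OreLocalization.oreSetOfNoZeroDivisors
    (fun r s => r * SliceRegular.conj s)
    (fun _ s => ⟨SliceRegular.conj s * s, SliceRegular.conj_mul_self_mem s⟩)
    (fun r s => by
      apply Subtype.ext
      change (regularConj _ * _) * _ = _ * regularConj _ * _
      rw [regularConj_mul_self_comm, mul_assoc])

/-- The skew field `L(ℍ)` of left `*`-quotients of slice regular functions on `ℍ`. -/
abbrev SemiRegular : Type := OreLocalization (SliceRegular)⁰ SliceRegular

/-- The inclusion of `ℍ[q]` in `SR(ℍ)`. -/
def slicePolyToRegular : SlicePoly₁ →+* SliceRegular :=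
  (Polynomial.coeToPowerSeries.ringHom).codRestrict SliceRegular isEntireSeries_coe

/-- The inclusion of `ℍ[q]` in `L(ℍ)`. -/
def slicePolyToSemiRegular : SlicePoly₁ →+* SemiRegular :=
  OreLocalization.numeratorRingHom.comp slicePolyToRegular

/-! ### The Dieudonné determinant -/

/-- The maximal abelian quotient of the multiplicative group of a skew field, together with the
class of `0`. -/
abbrev AbelianQuotient (F : Type*) [DivisionRing F] : Type _ := WithZero (Abelianization Fˣ)

open Classical in
/-- The class `[x]` of an element of a skew field. -/
def abelianClass {F : Type*} [DivisionRing F] (x : F) : AbelianQuotient F :=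
  if h : x = 0 then 0 else (Abelianization.of (Units.mk0 x h) : Abelianization Fˣ)

open Classical in
/-- The Dieudonné determinant, by row reduction.  If the first column of `A` is zero, it is `0`.
Otherwise choose `k` with `A k 0 ≠ 0`, clear the rest of the first column by subtracting left
multiples of row `k`, and delete the first column and row `k`; the determinant is the product of
`[A k 0]` and the determinant of the remaining matrix.  The sign `(-1) ^ k` makes the definition
independent of `k` over every skew field; over a skew field that contains the quaternions
`[-1] = [1]`, as `-1` is a commutator. -/
def dieudonneDet {F : Type*} [DivisionRing F] :
    (n : ℕ) → Matrix (Fin n) (Fin n) F → AbelianQuotient F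
  | 0, _ => 1
  | n + 1, A =>
    if h : ∃ k : Fin (n + 1), A k 0 ≠ 0 then
      let k := h.choose
      abelianClass ((-1) ^ (k : ℕ) * A k 0) *
        dieudonneDet n (Matrix.of fun i j : Fin n =>
          A (k.succAbove i) j.succ - A (k.succAbove i) 0 * (A k 0)⁻¹ * A k j.succ)
    else 0

/-! ### The regular resultant with respect to `q₂` -/

namespace SlicePoly₂

/-- The Sylvester matrix `B(q₁)` of `P` and `Q` as polynomials in `q₂` with coefficients in
`ℍ[q₁]`: the first `deg_{q₂} Q` columns hold the shifted coefficients of `P`, the last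
`deg_{q₂} P` columns those of `Q`. -/
def sylvester₂ (P Q : SlicePoly₂) :
    Matrix (Fin (Q.degree₂ + P.degree₂)) (Fin (Q.degree₂ + P.degree₂)) SlicePoly₁ :=
  Polynomial.sylvester Q P Q.degree₂ P.degree₂

/-- The regular resultant `Res(P, Q; q₂)`: the Dieudonné determinant over `L(ℍ)` of the Sylvester
matrix of `P` and `Q`. -/
def regularResultant₂ (P Q : SlicePoly₂) : AbelianQuotient SemiRegular :=
  dieudonneDet _ ((P.sylvester₂ Q).map slicePolyToSemiRegular)

end SlicePoly₂

end

/-! Since `n ≥ 2`, `P = (q₂ - b) * (q₂ - b) * T`; as the derivative of `q₂ - b` is `1`, Leibniz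
leaves a left factor `q₂ - b` in `P_{q₂}` too. Evaluation at `b` with powers on the left kills every
left multiple of `q₂ - b`. The Sylvester columns are shifted coefficient vectors, so the row `(1, b,
b², …)` annihilates them all (`pow_vecMul_sylvester_eq_zero`). Row reduction by left multiples
preserves left dependence of the rows, so the Dieudonné determinant is `0`. -/

open Matrix in
/-- The Dieudonné determinant vanishes if the rows are left linearly dependent. -/
theorem dieudonneDet_eq_zero_of_vecMul_eq_zero {F : Type*} [DivisionRing F] :
    ∀ {n : ℕ} {A : Matrix (Fin n) (Fin n) F} {v : Fin n → F},
      v ≠ 0 → v ᵥ* A = 0 → dieudonneDet n A = 0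
  | 0, _, v, hv, _ => (hv (Subsingleton.elim v 0)).elim
  | n + 1, A, v, hv, h => by
    rw [dieudonneDet]
    split_ifs with hk
    · have hk' := hk.choose_spec
      generalize hk.choose = k at hk'
      have hsum (j : Fin (n + 1)) :
          ∑ i, v (k.succAbove i) * A (k.succAbove i) j = -(v k * A k j) := by
        have := congrFun h j
        rw [vecMul, dotProduct, Fin.sum_univ_succAbove _ k] at this
        exact eq_neg_of_add_eq_zero_right this
      -- Dropping entry `k` of `v` gives a left null vector of the reduced matrix; it is nonzero,
      -- since otherwise column `0` and the pivot `A k 0 ≠ 0` force `v k = 0`.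
      refine mul_eq_zero_of_right _
        (dieudonneDet_eq_zero_of_vecMul_eq_zero (v := v ∘ k.succAbove) (fun hv' => hv ?_) ?_)
      · have hne (i : Fin n) : v (k.succAbove i) = 0 := congrFun hv' i
        have hvk : v k = 0 := by simpa [hne, hk'] using hsum 0
        funext i
        rcases Fin.eq_self_or_eq_succAbove k i with rfl | ⟨i, rfl⟩
        exacts [hvk, hne i]
      · funext j
        simp only [vecMul, dotProduct, Function.comp_apply, of_apply, mul_sub,
          Finset.sum_sub_distrib, ← mul_assoc, ← Finset.sum_mul, hsum, Pi.zero_apply]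
        simp [hk']
    · rfl

namespace Polynomial

variable {R : Type*} [Ring R]

/-- The partial sums of the value at `b`, with powers of `b` on the left, of a left multiple of
`X - b`. -/
theorem sum_pow_mul_coeff_X_sub_C_mul (b : R) (T : R[X]) (n : ℕ) :
    ∑ i ∈ Finset.range (n + 1), b ^ i * ((X - C b) * T).coeff i = -(b ^ (n + 1) * T.coeff n) := by
  induction n with
  | zero => simp [sub_mul]
  | succ n ih =>
    -- The sum telescopes: coefficient `n + 1` of the product is `T.coeff n - b * T.coeff (n + 1)`.
    rw [Finset.sum_range_succ, ih, sub_mul, coeff_sub, coeff_X_mul, coeff_C_mul, mul_sub,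
      ← mul_assoc, ← pow_succ]
    abel

/-- The telescoping remainder involves a coefficient of `T` beyond its degree: as `X - C b` is
monic, the product has degree exactly one more than `T ≠ 0`. -/
theorem sum_pow_mul_coeff_natDegree_X_sub_C_mul (b : R) (T : R[X]) :
    ∑ i ∈ Finset.range (((X - C b) * T).natDegree + 1), b ^ i * ((X - C b) * T).coeff i = 0 := by
  rw [sum_pow_mul_coeff_X_sub_C_mul]
  nontriviality R
  rcases eq_or_ne T 0 with rfl | hT
  · simp
  · rw [(monic_X_sub_C b).natDegree_mul' hT, natDegree_X_sub_C,
      coeff_eq_zero_of_natDegree_lt (by omega), mul_zero, neg_zero]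

/-- The sum runs down one Sylvester column. A shift by `j` pulls out `b ^ j` on the left, and `hN`
keeps the whole window inside the matrix. -/
theorem sum_pow_mul_shifted_coeff {b : R} {g : R[X]} {n j N : ℕ} (hN : j + n < N)
    (hg : ∑ i ∈ Finset.range (n + 1), b ^ i * g.coeff i = 0) :
    ∑ i : Fin N, b ^ (i : ℕ) *
      (if (i : ℕ) ∈ Set.Icc j (j + n) then g.coeff (i - j) else 0) = 0 := by
  classical
  rw [Fin.sum_univ_eq_sum_range
    (fun i => b ^ i * (if i ∈ Set.Icc j (j + n) then g.coeff (i - j) else 0))]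
  simp only [mul_ite, mul_zero]
  rw [← Finset.sum_filter]
  have hset : (Finset.range N).filter (fun i => i ∈ Set.Icc j (j + n)) =
      Finset.Ico j (j + (n + 1)) := by
    ext i
    simp only [Finset.mem_filter, Finset.mem_range, Set.mem_Icc, Finset.mem_Ico]
    omega
  rw [hset, Finset.sum_Ico_eq_sum_range, Nat.add_sub_cancel_left]
  simp only [Nat.add_sub_cancel_left, pow_add, mul_assoc, ← Finset.mul_sum, hg, mul_zero]

open Matrix in
/-- A common left factor `X - b` of `f` and `g` makes the powers of `b` a left null vector of their
Sylvester matrix. -/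
theorem pow_vecMul_sylvester_eq_zero (b : R) (f g : R[X]) (hf : (X - C b) ∣ f)
    (hg : (X - C b) ∣ g) :
    (fun i : Fin (f.natDegree + g.natDegree) => b ^ (i : ℕ)) ᵥ* sylvester f g f.natDegree g.natDegree = 0 := by
  obtain ⟨S, rfl⟩ := hf
  obtain ⟨T, rfl⟩ := hg
  funext j
  induction j using Fin.addCases with
  | left j =>
    simpa [vecMul, dotProduct, sylvester] using
      sum_pow_mul_shifted_coeff (by omega) (sum_pow_mul_coeff_natDegree_X_sub_C_mul b T)
  | right j =>
    simpa [vecMul, dotProduct, sylvester] using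
      sum_pow_mul_shifted_coeff (by omega) (sum_pow_mul_coeff_natDegree_X_sub_C_mul b S)

end Polynomial

namespace SlicePoly₂

/-- The regular resultant vanishes if `P` and `Q` have a common left factor `q₂ - b` and do not
both have degree `0`. -/
theorem regularResultant₂_eq_zero_of_q₂Sub_dvd {P Q : SlicePoly₂} {b : ℍ[ℝ]}
    (hP : q₂Sub b ∣ P) (hQ : q₂Sub b ∣ Q) (hdeg : 0 < P.degree₂) :
    P.regularResultant₂ Q = 0 := by
  have h := pow_vecMul_sylvester_eq_zero (C b) Q P hQ hP
  refine dieudonneDet_eq_zero_of_vecMul_eq_zero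
    (v := slicePolyToSemiRegular ∘ fun i : Fin (Q.degree₂ + P.degree₂) => C b ^ (i : ℕ)) (fun hv => ?_) ?_
  -- Entry `0` is `b ^ 0 = 1`; `hdeg` ensures that it exists, the empty matrix having determinant
  -- `1`.
  · have := congrFun hv ⟨0, by omega⟩
    simp at this
  · funext j
    have := RingHom.map_vecMul slicePolyToSemiRegular (P.sylvester₂ Q)
      (fun i : Fin (Q.degree₂ + P.degree₂) => C b ^ (i : ℕ)) j
    rw [← this]
    exact (congrArg slicePolyToSemiRegular (congrFun h j)).trans (map_zero _)

end SlicePoly₂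

theorem mainTheorem8 (P : SlicePoly₂) (a b : ℍ[ℝ]) (hb : b ∈ Set.centralizer {a})
    (hab : P.evalAt a b = 0) (n : ℕ) (hn : P.HasMultiplicity₂ b n) (h2 : 2 ≤ n) :
    P.regularResultant₂ P.cullenDeriv₂ = 0 := by
  obtain ⟨-, S, hS, hPS⟩ := hn
  obtain ⟨k, rfl⟩ := Nat.exists_eq_add_of_le' h2
  have hS0 : S ≠ 0 := by
    rintro rfl
    exact hS fun z _ => by simp [SlicePoly₂.evalAt]
  have hP : P = SlicePoly₂.q₂Sub b * (SlicePoly₂.q₂Sub b * (SlicePoly₂.q₂Sub b ^ k * S)) := by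
    rw [hPS, pow_succ', pow_succ', mul_assoc, mul_assoc]
  refine SlicePoly₂.regularResultant₂_eq_zero_of_q₂Sub_dvd (b := b) (hP ▸ dvd_mul_right _ _) ?_ ?_
  · rw [SlicePoly₂.cullenDeriv₂, hP, derivative_mul]
    have h1 : derivative (SlicePoly₂.q₂Sub b) = 1 := derivative_X_sub_C _
    rw [h1, one_mul]
    -- Here `∣` means divisibility on the left, which both Leibniz terms satisfy.
    exact dvd_add (dvd_mul_right _ _) (dvd_mul_right _ _)
  · rw [SlicePoly₂.degree₂, hPS, SlicePoly₂.q₂Sub,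
      ((monic_X_sub_C (C b)).pow (k + 2)).natDegree_mul' hS0,
      (monic_X_sub_C (C b)).natDegree_pow, natDegree_X_sub_C]
    omega
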